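/- Let $(X,d)$ be a metric space and let $\mu$ be a Borel measure on $X$ such that nonempty open sets have positive measure and bounded sets have finite measure. Let $\mathcal B_0$ be the set of open balls $B(x,r)$, $x\in X$, $r>0$. Assume that $\mu$ is Ahlfors $Q$-regular for some $Q>0$: there are constants $c,C>0$ with $c\,\mathrm{diam}(B)^Q\le\mu(B)\le C\,\mathrm{diam}(B)^Q$ for every $B\in\mathcal B_0$ with $\mathrm{diam}\,B\le 2\,\mathrm{diam}\,X$. Let $\varphi:X\to X$ be a Borel map that is non-singular, i.e. $\mu(\varphi^{-1}(E))=0$ whenever $E$ is Borel with $\mu(E)=0$. Let $u_\varphi:X\to[0,\infty]$ be the Radon–Nikodym density of $E\mapsto\mu(\varphi^{-1}(E))$ with respect to $\mu$, and let $C_\varphi f=f\circ\varphi$. For a Borel function $p:X\to[1,\infty)$ and a Borel set $A$ put $p_A^+=\operatorname{ess\,sup}_{A}p$, $p_A^-=\operatorname{ess\,inf}_{A}p$ (equal to $0$ and $\infty$, respectively, if $\mu(A)=0$), and $p^+=p^+_X$. Write $p\in LH_0(X)$ if there is $K_0$ with $|p(x)-p(y)|\le K_0/(-\log d(x,y))$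 for all $x\neq y$ with $d(x,y)<\frac12$, and $p\in LH_\infty(X)$ if there are $x_0\in X$, $K_\infty$ and $p_\infty$ with $|p(x)-p_\infty|\le K_\infty/\log(e+d(x,x_0))$ for all $x\in X$. Define $$[\varphi]_{p^+}=\inf_{B\in\mathcal B_0}\frac{p_B^+}{p^+_{\varphi^{-1}(B)}},\qquad [\varphi]_{p^-}=\sup_{B\in\mathcal B_0}\frac{p_B^-}{p^-_{\varphi^{-1}(B)}},$$ where a ball with $\mu(\varphi^{-1}(B))=0$ imposes no restriction (its quotients are $\infty$ and $0$, respectively). Let $\mathcal P^{\log}_{\varphi^+}(X)$ be the set of $p\in LH_0(X)\cap LH_\infty(X)$ with $[\varphi]_{p^+}\ge1$, let $\mathcal P^{\log}_{\varphi^-}(X)$ be the set of $p\in LH_0(X)$ with $[\varphi]_{p^-}\le1$, and let $\mathcal P^{\log}_\varphi(X)$ be their intersection. Let $\rho(f)=\int_X|f(x)|^{p(x)}\,d\mu(x)$, let $L^{p(\cdot)}(X)$ be the space of measurable $f:X\to\mathbb R$ with $\rho(f/\eta)<\infty$ for some $\eta>0$, and let $\|f\|_{p(\cdot)}=\inf\{\eta>0:\rho(f/\eta)\le1\}$.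 Put $\mathcal U(\varphi)=\sup_{B\in\mathcal B_0}\mu(\varphi^{-1}(B))/\mu(B)$. Then: (c1) If $p\in\mathcal P^{\log}_{\varphi^+}(X)$ and $u_\varphi$ is essentially bounded, then $C_\varphi$ maps $L^{p(\cdot)}(X)$ into itself, and it is bounded: there is $C$ with $\|f\circ\varphi\|_{p(\cdot)}\le C\|f\|_{p(\cdot)}$ for all $f\in L^{p(\cdot)}(X)$. (c2) If $p\in\mathcal P^{\log}_{\varphi^-}(X)$, $p^+<\infty$, and $C_\varphi$ maps $L^{p(\cdot)}(X)$ into itself, then there is a constant $C>0$ with $\mu(\varphi^{-1}(B))\le C\,\mu(B)$ for every $B\in\mathcal B_0$, i.e. $\mathcal U(\varphi)<\infty$. (c3) If $p\in\mathcal P^{\log}_{\varphi}(X)$ and in addition $\mu$ is doubling (there is $C>0$ with $\mu(B(x,2r))\le C\mu(B(x,r))$ for all $x\in X$, $r>0$), then the following are equivalent: $u_\varphi$ is essentially bounded; $C_\varphi$ maps $L^{p(\cdot)}(X)$ into itself; $C_\varphi$ is a bounded operator on $L^{p(\cdot)}(X)$; there is a constant $C>0$ with $\mu(\varphi^{-1}(B))\le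 C\,\mu(B)$ for every $B\in\mathcal B_0$; $\mathcal U(\varphi)<\infty$. -/

import Mathlib

open MeasureTheory Set
open scoped ENNReal NNReal

noncomputable section

namespace VarLp

variable {X : Type*} [MetricSpace X] [MeasurableSpace X]

/-- `μ` is Ahlfors `Q`-regular: `μ(B) ≈ diam(B)^Q` for every open ball `B` with
`diam B ≤ 2 diam X`. Diameters take values in `[0, ∞]`. -/
def AhlforsRegular (μ : Measure X) (Q : ℝ) : Prop :=
  ∃ c C : ℝ≥0, 0 < c ∧ 0 < C ∧ ∀ (x : X) (r : ℝ), 0 < r →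
    Metric.ediam (Metric.ball x r) ≤ 2 * Metric.ediam (univ : Set X) →
      (c : ℝ≥0∞) * Metric.ediam (Metric.ball x r) ^ Q ≤ μ (Metric.ball x r) ∧
      μ (Metric.ball x r) ≤ (C : ℝ≥0∞) * Metric.ediam (Metric.ball x r) ^ Q

/-- The doubling condition `μ(B(x,2r)) ≤ C μ(B(x,r))` for every ball. -/
def Doubling (μ : Measure X) : Prop :=
  ∃ C : ℝ≥0, 0 < C ∧ ∀ (x : X) (r : ℝ), 0 < r →
    μ (Metric.ball x (2 * r)) ≤ (C : ℝ≥0∞) * μ (Metric.ball x r)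

/-- Variable exponents: Borel functions `p : X → [1, ∞)`. -/
def IsExponent (p : X → ℝ) : Prop :=
  Measurable p ∧ ∀ x, 1 ≤ p x

/-- `p⁺_A`, the essential supremum of `p` over `A`, in `[0, ∞]`
(it is `0` if `A` is a null set). -/
def expSup (μ : Measure X) (p : X → ℝ) (A : Set X) : ℝ≥0∞ :=
  essSup (fun x => ENNReal.ofReal (p x)) (μ.restrict A)

/-- `p⁻_A`, the essential infimum of `p` over `A`, in `[0, ∞]`
(it is `∞` if `A` is a null set). -/
def expInf (μ : Measure X) (p : X → ℝ) (A : Set X) : ℝ≥0∞ :=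
  essInf (fun x => ENNReal.ofReal (p x)) (μ.restrict A)

/-- Local log-Hölder continuity. For `x = y` both sides are `0`. -/
def LH0 (p : X → ℝ) : Prop :=
  ∃ K : ℝ, ∀ x y : X, dist x y < 1 / 2 → |p x - p y| ≤ K / (-Real.log (dist x y))

/-- Log-Hölder continuity at infinity, with some base point `x₀`
(the condition does not depend on the base point). -/
def LHInfty (p : X → ℝ) : Prop :=
  ∃ (x₀ : X) (K pInf : ℝ), ∀ x : X,
    |p x - pInf| ≤ K / Real.log (Real.exp 1 + dist x x₀)

/-- `inf_B p⁺_B / p⁺_{φ⁻¹(B)}` over all open balls `B`. A ball with null preimage contributes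
`p⁺_B / 0 = ∞`, that is, no condition. -/
def ratioPlus (μ : Measure X) (φ : X → X) (p : X → ℝ) : ℝ≥0∞ :=
  ⨅ (x : X) (r : ℝ) (_ : 0 < r),
    expSup μ p (Metric.ball x r) / expSup μ p (φ ⁻¹' Metric.ball x r)

/-- `sup_B p⁻_B / p⁻_{φ⁻¹(B)}` over all open balls `B`. A ball with null preimage contributes
`p⁻_B / ∞ = 0`, that is, no condition. -/
def ratioMinus (μ : Measure X) (φ : X → X) (p : X → ℝ) : ℝ≥0∞ :=
  ⨆ (x : X) (r : ℝ) (_ : 0 < r),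
    expInf μ p (Metric.ball x r) / expInf μ p (φ ⁻¹' Metric.ball x r)

/-- The class `P^log_{φ⁺}(X)`. -/
def PLogPlus (μ : Measure X) (φ : X → X) (p : X → ℝ) : Prop :=
  IsExponent p ∧ LH0 p ∧ LHInfty p ∧ 1 ≤ ratioPlus μ φ p

/-- The class `P^log_{φ⁻}(X)`. -/
def PLogMinus (μ : Measure X) (φ : X → X) (p : X → ℝ) : Prop :=
  IsExponent p ∧ LH0 p ∧ ratioMinus μ φ p ≤ 1

/-- The class `P^log_φ(X)`. -/
def PLog (μ : Measure X) (φ : X → X) (p : X → ℝ) : Prop :=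
  PLogPlus μ φ p ∧ PLogMinus μ φ p

/-- The modular `ρ(f) = ∫ |f(x)|^{p(x)} dμ(x)`. -/
def modular (μ : Measure X) (p : X → ℝ) (f : X → ℝ) : ℝ≥0∞ :=
  ∫⁻ x, ENNReal.ofReal (|f x| ^ p x) ∂μ

/-- Membership of a real function in the variable Lebesgue space `L^{p(·)}(X)`. -/
def MemLpVar (μ : Measure X) (p : X → ℝ) (f : X → ℝ) : Prop :=
  AEMeasurable f μ ∧ ∃ η : ℝ, 0 < η ∧ modular μ p (fun x => f x / η) < ⊤

/-- The Luxemburg–Nakano norm. -/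
def luxNorm (μ : Measure X) (p : X → ℝ) (f : X → ℝ) : ℝ :=
  sInf {η : ℝ | 0 < η ∧ modular μ p (fun x => f x / η) ≤ 1}

/-- The composition operator `C_φ f = f ∘ φ` maps `L^{p(·)}(X)` into itself. -/
def CompMapsInto (μ : Measure X) (φ : X → X) (p : X → ℝ) : Prop :=
  ∀ f : X → ℝ, MemLpVar μ p f → MemLpVar μ p (f ∘ φ)

/-- The composition operator `C_φ` is a bounded operator from `L^{p(·)}(X)` to itself. -/
def CompBounded (μ : Measure X) (φ : X → X) (p : X → ℝ) : Prop :=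
  CompMapsInto μ φ p ∧
    ∃ C : ℝ, ∀ f : X → ℝ, MemLpVar μ p f → luxNorm μ p (f ∘ φ) ≤ C * luxNorm μ p f

/-- `u_φ`, the Radon–Nikodym density of `E ↦ μ(φ⁻¹(E))` with respect to `μ`,
with values in `[0, ∞]`. -/
def density (μ : Measure X) (φ : X → X) : X → ℝ≥0∞ :=
  (μ.map φ).rnDeriv μ

/-- `u_φ` is essentially bounded. -/
def DensityBounded (μ : Measure X) (φ : X → X) : Prop :=
  essSup (density μ φ) μ < ⊤

/-- There is a positive constant `C` with `μ(φ⁻¹(B)) ≤ C μ(B)` for every open ball `B`. -/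
def BallBound (μ : Measure X) (φ : X → X) : Prop :=
  ∃ C : ℝ≥0, 0 < C ∧ ∀ (x : X) (r : ℝ), 0 < r →
    μ (φ ⁻¹' Metric.ball x r) ≤ (C : ℝ≥0∞) * μ (Metric.ball x r)

/-- `U(φ) = sup_B μ(φ⁻¹(B)) / μ(B)` over all open balls `B`. -/
def ballSup (μ : Measure X) (φ : X → X) : ℝ≥0∞ :=
  ⨆ (x : X) (r : ℝ) (_ : 0 < r), μ (φ ⁻¹' Metric.ball x r) / μ (Metric.ball x r)

end VarLp

end

namespace VarLp

open Filter Topology Metric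

variable {X : Type*}

theorem sigmaFinite_of_isBounded_lt_top [MetricSpace X] [MeasurableSpace X]
    (μ : Measure X)
    (hfin : ∀ s : Set X, Bornology.IsBounded s → μ s < ⊤) : SigmaFinite μ := by
  rcases isEmpty_or_nonempty X with h | ⟨⟨x₀⟩⟩
  · rw [Measure.eq_zero_of_isEmpty μ]; infer_instance
  · refine ⟨⟨⟨fun n : ℕ => ball x₀ n, fun _ => trivial, fun n => hfin _ isBounded_ball, ?_⟩⟩⟩
    exact iUnion_ball_nat x₀

theorem isLocallyFiniteMeasure_of_isBounded_lt_top [MetricSpace X] [MeasurableSpace X]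
    (μ : Measure X)
    (hfin : ∀ s : Set X, Bornology.IsBounded s → μ s < ⊤) : IsLocallyFiniteMeasure μ :=
  ⟨fun x => ⟨ball x 1, ball_mem_nhds x one_pos, hfin _ isBounded_ball⟩⟩

theorem secondCountableTopology_of_sigmaFinite [MetricSpace X] [MeasurableSpace X]
    [OpensMeasurableSpace X] (μ : Measure X)
    [SigmaFinite μ] [μ.IsOpenPosMeasure] : SecondCountableTopology X := by
  refine Metric.secondCountable_of_almost_dense_set fun ε hε => ?_
  obtain ⟨S, -, hS⟩ := zorn_subset_nonempty
    {S : Set X | S.Pairwise fun x y => ε ≤ dist x y}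
    (fun c hc hchain _ => ⟨⋃₀ c, (pairwise_sUnion hchain.directedOn).2 fun s hs => hc hs,
      fun s hs => subset_sUnion_of_mem hs⟩) ∅ (by simp)
  refine ⟨S, ?_, fun x => ?_⟩
  · have hd : Pairwise (Function.onFun Disjoint fun x : S => ball (x : X) (ε / 2)) := by
      intro x y hxy
      refine ball_disjoint_ball ?_
      have := hS.prop x.2 y.2 (fun h => hxy (Subtype.ext h))
      linarith
    have := Measure.countable_meas_pos_of_disjoint_iUnion (μ := μ)
      (fun _ : S => measurableSet_ball) hd
    rw [← countable_coe_iff, ← countable_univ_iff]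
    refine this.mono fun x _ => ?_
    exact isOpen_ball.measure_pos μ ⟨x, mem_ball_self (by positivity)⟩
  · by_contra! hx
    have hmem : x ∈ S := by
      refine hS.le_of_ge (y := insert x S) ?_ (subset_insert _ _) (mem_insert _ _)
      refine pairwise_insert.2 ⟨hS.prop, ?_⟩
      exact fun b hb _ => ⟨(hx b hb).le, dist_comm x b ▸ (hx b hb).le⟩
    have := hx x hmem
    simp at this
    linarith

theorem LH0.continuous [MetricSpace X] {p : X → ℝ} (hp : LH0 p) : Continuous p := by
  obtain ⟨K, hK⟩ := hp
  rw [Metric.continuous_iff]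
  intro x ε hε
  refine ⟨min (1 / 2) (Real.exp (-(|K| / ε + 1))), by positivity, fun y hy => ?_⟩
  rcases eq_or_ne y x with rfl | hne
  · simpa
  have hd : 0 < dist y x := dist_pos.2 hne
  have h1 := hK y x (hy.trans_le (min_le_left _ _))
  have h2 : Real.log (dist y x) < -(|K| / ε + 1) :=
    (Real.log_lt_iff_lt_exp hd).2 (hy.trans_le (min_le_right _ _))
  have h3 : 0 ≤ |K| / ε := by positivity
  have h4 : 0 < -Real.log (dist y x) := by linarith
  rw [Real.dist_eq]
  refine h1.trans_lt ?_
  rw [div_lt_iff₀ h4]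
  have : |K| = ε * (|K| / ε) := by field_simp
  nlinarith [le_abs_self K]

theorem LHInfty.exists_le [MetricSpace X] {p : X → ℝ} (hp : LHInfty p) : ∃ P : ℝ, 1 ≤ P ∧ ∀ x, p x ≤ P := by
  obtain ⟨x₀, K, q, h⟩ := hp
  refine ⟨max 1 (q + |K|), le_max_left _ _, fun x => le_max_of_le_right ?_⟩
  have hl : 1 ≤ Real.log (Real.exp 1 + dist x x₀) := by
    rw [Real.le_log_iff_exp_le (by positivity)]
    linarith [dist_nonneg (x := x) (y := x₀)]
  have h1 : K / Real.log (Real.exp 1 + dist x x₀) ≤ |K| :=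
    (div_le_div_of_nonneg_right (le_abs_self K) (by linarith)).trans (div_le_self (abs_nonneg K) hl)
  linarith [le_abs_self (p x - q), h x]

theorem expSup_lt_top_of_le [MeasurableSpace X] {μ : Measure X} {p : X → ℝ} {P : ℝ} (h : ∀ x, p x ≤ P) (A : Set X) :
    expSup μ p A < ⊤ :=
  (essSup_le_of_ae_le (ENNReal.ofReal P)
    (Eventually.of_forall fun x => ENNReal.ofReal_le_ofReal (h x))).trans_lt ENNReal.ofReal_lt_top

theorem ae_forall_exists_small_ball [MetricSpace X] [MeasurableSpace X]
    [SecondCountableTopology X] {μ : Measure X} {φ : X → X}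
    {P : X → ℝ → X → Prop}
    (h : ∀ c r, 0 < r → ∀ᵐ x ∂μ, φ x ∈ ball c r → P c r x) :
    ∀ᵐ x ∂μ, ∀ δ > 0, ∃ c r, 0 < r ∧ ball c r ⊆ ball (φ x) δ ∧ P c r x := by
  obtain ⟨D, hDc, hD⟩ := TopologicalSpace.exists_countable_dense X
  have h1 : ∀ᵐ x ∂μ, ∀ c ∈ D, ∀ n : ℕ, φ x ∈ ball c (1 / (n + 1 : ℝ)) → P c (1 / (n + 1 : ℝ)) x :=
    (ae_ball_iff hDc).2 fun c _ => ae_all_iff.2 fun n => h c _ (by positivity)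
  filter_upwards [h1] with x hx δ hδ
  obtain ⟨n, hn⟩ := exists_nat_one_div_lt (half_pos hδ)
  have hr : (0 : ℝ) < 1 / (n + 1) := by positivity
  obtain ⟨c, hcD, hc⟩ := hD.exists_dist_lt (φ x) hr
  refine ⟨c, _, hr, ball_subset_ball' ?_, hx c hcD n hc⟩
  rw [dist_comm]
  linarith

theorem ae_le_expSup_preimage [MeasurableSpace X] {μ : Measure X} {φ : X → X} {p : X → ℝ} {A : Set X}
    (hA : MeasurableSet (φ ⁻¹' A)) :
    ∀ᵐ x ∂μ, φ x ∈ A → ENNReal.ofReal (p x) ≤ expSup μ p (φ ⁻¹' A) :=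
  (ae_restrict_iff' hA).1 (ENNReal.ae_le_essSup _)

theorem ae_expInf_preimage_le [MeasurableSpace X] {μ : Measure X} {φ : X → X} {p : X → ℝ} {A : Set X}
    (hA : MeasurableSet (φ ⁻¹' A)) :
    ∀ᵐ x ∂μ, φ x ∈ A → expInf μ p (φ ⁻¹' A) ≤ ENNReal.ofReal (p x) :=
  (ae_restrict_iff' hA).1 ae_essInf_le

theorem expSup_preimage_le [MetricSpace X] [MeasurableSpace X]
    {μ : Measure X} {φ : X → X} {p : X → ℝ} (h : 1 ≤ ratioPlus μ φ p)
    (hp : ∀ A, expSup μ p A < ⊤) (c : X) {r : ℝ} (hr : 0 < r) :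
    expSup μ p (φ ⁻¹' ball c r) ≤ expSup μ p (ball c r) := by
  have h1 : 1 ≤ expSup μ p (ball c r) / expSup μ p (φ ⁻¹' ball c r) :=
    h.trans (iInf_le_of_le c (iInf_le_of_le r (iInf_le _ hr)))
  rcases eq_or_ne (expSup μ p (φ ⁻¹' ball c r)) 0 with h0 | h0
  · rw [h0]; exact zero_le
  · simpa using (ENNReal.le_div_iff_mul_le (.inl h0) (.inl (hp _).ne)).1 h1

theorem expInf_le_preimage [MetricSpace X] [MeasurableSpace X]
    {μ : Measure X} {φ : X → X} {p : X → ℝ} (h : ratioMinus μ φ p ≤ 1)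
    (hp : IsExponent p) (c : X) {r : ℝ} (hr : 0 < r) :
    expInf μ p (ball c r) ≤ expInf μ p (φ ⁻¹' ball c r) := by
  have h1 : expInf μ p (ball c r) / expInf μ p (φ ⁻¹' ball c r) ≤ 1 :=
    le_trans (le_iSup_of_le c <| le_iSup_of_le r <|
      le_iSup (fun _ : 0 < r => expInf μ p (ball c r) / expInf μ p (φ ⁻¹' ball c r)) hr) h
  have h0 : 1 ≤ expInf μ p (φ ⁻¹' ball c r) :=
    le_essInf_of_ae_le _ (Eventually.of_forall fun x => by simpa using hp.2 x)
  rcases eq_or_ne (expInf μ p (φ ⁻¹' ball c r)) ⊤ with ht | ht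
  · rw [ht]; exact le_top
  · simpa using (ENNReal.div_le_iff (one_pos.trans_le h0).ne' ht).1 h1

section

variable [MetricSpace X] [MeasurableSpace X] [BorelSpace X]

theorem ae_le_comp_of_one_le_ratioPlus [SecondCountableTopology X] {μ : Measure X} {φ : X → X}
    (hφ : Measurable φ) {p : X → ℝ} (hc : Continuous p) (hp : IsExponent p)
    (hb : ∀ A, expSup μ p A < ⊤) (h : 1 ≤ ratioPlus μ φ p) :
    ∀ᵐ x ∂μ, p x ≤ p (φ x) := by
  have h1 := ae_forall_exists_small_ball (μ := μ) (φ := φ)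
    (P := fun c r x => ENNReal.ofReal (p x) ≤ expSup μ p (ball c r)) fun c r hr => by
      filter_upwards [ae_le_expSup_preimage (μ := μ) (p := p) (hφ (measurableSet_ball (x := c)
        (ε := r)))] with x hx hxm
      exact (hx hxm).trans (expSup_preimage_le h hb c hr)
  filter_upwards [h1] with x hx
  refine le_of_forall_pos_le_add fun ε hε => ?_
  obtain ⟨δ, hδ, hδp⟩ := Metric.continuous_iff.1 hc (φ x) ε hε
  obtain ⟨c, r, hr, hsub, hle⟩ := hx δ hδ
  have h2 : expSup μ p (ball c r) ≤ ENNReal.ofReal (p (φ x) + ε) := by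
    refine essSup_le_of_ae_le _ ?_
    filter_upwards [ae_restrict_mem measurableSet_ball] with y hy
    refine ENNReal.ofReal_le_ofReal ?_
    have := (abs_lt.1 (Real.dist_eq _ _ ▸ hδp y (hsub hy))).2
    linarith
  exact (ENNReal.ofReal_le_ofReal_iff (by linarith [hp.2 (φ x)])).1 (hle.trans h2)

theorem ae_comp_le_of_ratioMinus_le_one [SecondCountableTopology X] {μ : Measure X} {φ : X → X}
    (hφ : Measurable φ) {p : X → ℝ} (hc : Continuous p) (hp : IsExponent p)
    (h : ratioMinus μ φ p ≤ 1) :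
    ∀ᵐ x ∂μ, p (φ x) ≤ p x := by
  have h1 := ae_forall_exists_small_ball (μ := μ) (φ := φ)
    (P := fun c r x => expInf μ p (ball c r) ≤ ENNReal.ofReal (p x)) fun c r hr => by
      filter_upwards [ae_expInf_preimage_le (μ := μ) (p := p) (hφ (measurableSet_ball (x := c)
        (ε := r)))] with x hx hxm
      exact (expInf_le_preimage h hp c hr).trans (hx hxm)
  filter_upwards [h1] with x hx
  refine le_of_forall_pos_le_add fun ε hε => ?_
  obtain ⟨δ, hδ, hδp⟩ := Metric.continuous_iff.1 hc (φ x) ε hε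
  obtain ⟨c, r, hr, hsub, hle⟩ := hx δ hδ
  have h2 : ENNReal.ofReal (p (φ x) - ε) ≤ expInf μ p (ball c r) := by
    refine le_essInf_of_ae_le _ ?_
    filter_upwards [ae_restrict_mem measurableSet_ball] with y hy
    refine ENNReal.ofReal_le_ofReal ?_
    have := (abs_lt.1 (Real.dist_eq _ _ ▸ hδp y (hsub hy))).1
    linarith
  have := (ENNReal.ofReal_le_ofReal_iff (by linarith [hp.2 x])).1 (h2.trans hle)
  linarith

end

theorem rpow_le_of_logHolder {F a b t K N : ℝ} (hF : 0 ≤ F) (ht : Real.exp 1 ≤ t) (ha : 1 ≤ a)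
    (hab : a ≤ b) (hK : b - a ≤ K / Real.log t) (hN : 0 ≤ N) :
    F ^ a ≤ Real.exp (N * K) * F ^ b + t ^ (-N) := by
  have ht0 : 0 < t := (Real.exp_pos 1).trans_le ht
  have ht1 : 1 ≤ t := (Real.one_le_exp zero_le_one).trans ht
  have hl : 1 ≤ Real.log t := (Real.le_log_iff_exp_le ht0).2 ht
  have hbK : (b - a) * Real.log t ≤ K := (le_div_iff₀ (by linarith)).1 hK
  have hK0 : 0 ≤ K := (mul_nonneg (by linarith) (by linarith)).trans hbK
  have hFb : 0 ≤ F ^ b := Real.rpow_nonneg hF b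
  have htN : 0 < t ^ (-N) := Real.rpow_pos_of_pos ht0 _
  rcases le_or_gt 1 F with h1 | h1
  · have : 1 ≤ Real.exp (N * K) := Real.one_le_exp (mul_nonneg hN hK0)
    have := Real.rpow_le_rpow_of_exponent_le h1 hab
    nlinarith
  rcases le_or_gt (t ^ (-N)) F with h2 | h2
  · have hF0 : 0 < F := htN.trans_le h2
    have h3 : F ^ (a - b) ≤ Real.exp (N * K) := by
      calc F ^ (a - b) ≤ (t ^ (-N)) ^ (a - b) :=
            Real.rpow_le_rpow_of_nonpos htN h2 (by linarith)
        _ = Real.exp (N * ((b - a) * Real.log t)) := by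
            rw [← Real.rpow_mul ht0.le, Real.rpow_def_of_pos ht0]
            ring_nf
        _ ≤ _ := Real.exp_le_exp.2 (mul_le_mul_of_nonneg_left hbK hN)
    calc F ^ a = F ^ (a - b) * F ^ b := by rw [← Real.rpow_add hF0]; ring_nf
      _ ≤ Real.exp (N * K) * F ^ b := mul_le_mul_of_nonneg_right h3 hFb
      _ ≤ _ := by linarith
  · have h3 : F ^ a ≤ F ^ (1 : ℝ) := by
      rcases hF.eq_or_lt with rfl | hF0
      · rw [Real.zero_rpow (by linarith), Real.zero_rpow one_ne_zero]
      · exact Real.rpow_le_rpow_of_exponent_ge hF0 h1.le ha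
    rw [Real.rpow_one] at h3
    have := mul_nonneg (Real.exp_pos (N * K)).le hFb
    linarith

theorem AhlforsRegular.exists_measure_ball_le [MetricSpace X] [MeasurableSpace X] {μ : Measure X}
    {Q : ℝ} (hQ : 0 < Q) (h : AhlforsRegular μ Q) :
    ∃ C : ℝ, 0 < C ∧ ∀ (x : X) (r : ℝ), 0 < r → μ (ball x r) ≤ ENNReal.ofReal (C * r ^ Q) := by
  obtain ⟨_, C, -, hC, h⟩ := h
  refine ⟨C * 2 ^ Q, by positivity, fun x r hr => ?_⟩
  have hle : ediam (ball x r) ≤ 2 * ediam (univ : Set X) :=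
    (ediam_mono (subset_univ _)).trans (le_mul_of_one_le_left zero_le one_le_two)
  have hd : ediam (ball x r) ≤ ENNReal.ofReal (2 * r) := by
    rw [← eball_ofReal, ENNReal.ofReal_mul zero_le_two, ENNReal.ofReal_ofNat]
    exact ediam_eball_le
  refine (h x r hr hle).2.trans ?_
  calc (C : ℝ≥0∞) * ediam (ball x r) ^ Q ≤ C * ENNReal.ofReal (2 * r) ^ Q := by gcongr
    _ = ENNReal.ofReal (C * 2 ^ Q * r ^ Q) := by
      rw [ENNReal.ofReal_rpow_of_pos (by positivity), mul_assoc,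
        ENNReal.ofReal_mul (p := (C : ℝ)) C.2, Real.mul_rpow zero_le_two hr.le]
      simp

theorem lintegral_rpow_neg_dist_lt_top [MetricSpace X] [MeasurableSpace X]
    [OpensMeasurableSpace X] {μ : Measure X} {C Q : ℝ} (hC : 0 < C)
    (h : ∀ (x : X) (r : ℝ), 0 < r → μ (ball x r) ≤ ENNReal.ofReal (C * r ^ Q)) (x₀ : X)
    (hQ : 0 < Q) :
    ∫⁻ x, ENNReal.ofReal ((Real.exp 1 + dist x x₀) ^ (-(Q + 1))) ∂μ < ⊤ := by
  have key : ∀ x, ENNReal.ofReal ((Real.exp 1 + dist x x₀) ^ (-(Q + 1))) ≤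
      ∑' k : ℕ, (ball x₀ ((2 : ℝ) ^ (k + 1))).indicator
        (fun _ => ENNReal.ofReal (((2 : ℝ) ^ k) ^ (-(Q + 1)))) x := by
    intro x
    have h1 : 1 ≤ Real.exp 1 + dist x x₀ :=
      (Real.one_le_exp zero_le_one).trans (le_add_of_nonneg_right dist_nonneg)
    obtain ⟨k, hk, hk'⟩ := exists_nat_pow_near h1 one_lt_two
    refine le_trans ?_ (ENNReal.le_tsum k)
    rw [indicator_of_mem (mem_ball.2 (by linarith [Real.exp_pos 1]))]
    exact ENNReal.ofReal_le_ofReal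
      (Real.rpow_le_rpow_of_nonpos (by positivity) hk (by linarith))
  refine (lintegral_mono key).trans_lt ?_
  rw [lintegral_tsum fun k => (measurable_const.indicator measurableSet_ball).aemeasurable]
  have hk : ∀ k : ℕ, ∫⁻ x, (ball x₀ ((2 : ℝ) ^ (k + 1))).indicator
      (fun _ => ENNReal.ofReal (((2 : ℝ) ^ k) ^ (-(Q + 1)))) x ∂μ ≤
      ENNReal.ofReal (C * 2 ^ Q * (1 / 2) ^ k) := by
    intro k
    rw [lintegral_indicator_const measurableSet_ball]
    refine (mul_le_mul_right (h x₀ (2 ^ (k + 1)) (by positivity)) _).trans ?_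
    rw [← ENNReal.ofReal_mul (by positivity)]
    refine ENNReal.ofReal_le_ofReal (le_of_eq ?_)
    have h2 : (0 : ℝ) < 2 ^ k := by positivity
    rw [Real.rpow_neg h2.le, Real.rpow_add h2, Real.rpow_one, pow_succ,
      Real.mul_rpow h2.le zero_le_two, one_div, inv_pow]
    field_simp
  refine (ENNReal.tsum_le_tsum hk).trans_lt ?_
  rw [← ENNReal.ofReal_tsum_of_nonneg (fun k => by positivity)
    ((summable_geometric_of_lt_one (by norm_num) (by norm_num)).mul_left _)]
  exact ENNReal.ofReal_lt_top

section Modular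

variable [MeasurableSpace X] {μ : Measure X} {φ : X → X} {p : X → ℝ}

theorem map_le_essSup_density_smul [SigmaFinite μ]
    (hφ : Measure.QuasiMeasurePreserving φ μ μ) :
    μ.map φ ≤ essSup (density μ φ) μ • μ := by
  rw [← Measure.withDensity_rnDeriv_eq _ _ hφ.absolutelyContinuous, ← withDensity_const]
  exact withDensity_mono (ENNReal.ae_le_essSup _)

theorem lintegral_comp_le_of_density [SigmaFinite μ]
    (hφ : Measure.QuasiMeasurePreserving φ μ μ) {g : X → ℝ≥0∞} (hg : AEMeasurable g μ) :
    ∫⁻ x, g (φ x) ∂μ ≤ essSup (density μ φ) μ * ∫⁻ x, g x ∂μ := by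
  rw [← lintegral_map' (hg.mono_ac hφ.absolutelyContinuous) hφ.measurable.aemeasurable,
    ← smul_eq_mul, ← lintegral_smul_measure]
  exact lintegral_mono' (map_le_essSup_density_smul hφ) le_rfl

theorem aemeasurable_modular_integrand (hp : Measurable p) {f : X → ℝ} (hf : AEMeasurable f μ) :
    AEMeasurable (fun x => ENNReal.ofReal (|f x| ^ p x)) μ :=
  (hf.abs.pow hp.aemeasurable).ennreal_ofReal

theorem modular_div_le (hp : ∀ x, 1 ≤ p x) {M : ℝ} (hM : 1 ≤ M) (f : X → ℝ) :
    modular μ p (fun x => f x / M) ≤ ENNReal.ofReal M⁻¹ * modular μ p f := by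
  have hM0 : 0 < M := one_pos.trans_le hM
  rw [modular, modular, ← lintegral_const_mul' _ _ ENNReal.ofReal_ne_top]
  refine lintegral_mono fun x => ?_
  rw [← ENNReal.ofReal_mul (by positivity)]
  refine ENNReal.ofReal_le_ofReal ?_
  rw [abs_div, abs_of_pos hM0, Real.div_rpow (abs_nonneg _) hM0.le, inv_mul_eq_div]
  have : M ≤ M ^ p x := by simpa using Real.rpow_le_rpow_of_exponent_le hM (hp x)
  exact div_le_div_of_nonneg_left (by positivity) hM0 this

theorem modular_div_le_one (hp : ∀ x, 1 ≤ p x) {M : ℝ} (hM : 1 ≤ M) {f : X → ℝ}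
    (hf : modular μ p f ≤ ENNReal.ofReal M) : modular μ p (fun x => f x / M) ≤ 1 := by
  refine (modular_div_le hp hM f).trans ((mul_le_mul_right hf _).trans ?_)
  rw [← ENNReal.ofReal_mul (by positivity), inv_mul_cancel₀ (by positivity), ENNReal.ofReal_one]

theorem luxNorm_set_nonempty (hp : ∀ x, 1 ≤ p x) {f : X → ℝ} (hf : MemLpVar μ p f) :
    {η : ℝ | 0 < η ∧ modular μ p (fun x => f x / η) ≤ 1}.Nonempty := by
  obtain ⟨-, η, hη, hlt⟩ := hf
  set M : ℝ := max 1 (modular μ p (fun x => f x / η)).toReal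
  have hM : 1 ≤ M := le_max_left _ _
  refine ⟨η * M, by positivity, ?_⟩
  have := modular_div_le_one hp hM (f := fun x => f x / η)
    ((ENNReal.ofReal_toReal hlt.ne).symm.le.trans (ENNReal.ofReal_le_ofReal (le_max_right _ _)))
  simpa only [div_div] using this

theorem compBounded_of_modular_comp_le (hφ : Measure.QuasiMeasurePreserving φ μ μ)
    (hp : ∀ x, 1 ≤ p x) {A B : ℝ≥0∞} (hA : A ≠ ⊤) (hB : B ≠ ⊤)
    (h : ∀ f : X → ℝ, AEMeasurable f μ → modular μ p (f ∘ φ) ≤ A * modular μ p f + B) :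
    CompBounded μ φ p := by
  have h' : ∀ f : X → ℝ, AEMeasurable f μ → ∀ η : ℝ,
      modular μ p (fun x => (f ∘ φ) x / η) ≤ A * modular μ p (fun x => f x / η) + B :=
    fun f hf η => h (fun x => f x / η) (hf.div_const η)
  refine ⟨fun f hf => ⟨hf.1.comp_quasiMeasurePreserving hφ, ?_⟩, max 1 (A + B).toReal,
    fun f hf => ?_⟩
  · obtain ⟨hm, η, hη, hlt⟩ := hf
    exact ⟨η, hη, (h' f hm η).trans_lt
      (ENNReal.add_lt_top.2 ⟨ENNReal.mul_lt_top hA.lt_top hlt, hB.lt_top⟩)⟩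
  · have hM : (1 : ℝ) ≤ max 1 (A + B).toReal := le_max_left _ _
    rw [← div_le_iff₀' (by positivity)]
    refine le_csInf (luxNorm_set_nonempty hp hf) fun η ⟨hη, hle⟩ => ?_
    rw [div_le_iff₀' (by positivity)]
    refine csInf_le ⟨0, fun y hy => hy.1.le⟩ ⟨by positivity, ?_⟩
    have h1 : modular μ p (fun x => (f ∘ φ) x / η) ≤ ENNReal.ofReal (max 1 (A + B).toReal) := by
      refine (h' f hf.1 η).trans ?_
      calc A * modular μ p (fun x => f x / η) + B ≤ A * 1 + B := by gcongr
        _ = ENNReal.ofReal (A + B).toReal := by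
          rw [mul_one, ENNReal.ofReal_toReal (ENNReal.add_ne_top.2 ⟨hA, hB⟩)]
        _ ≤ _ := ENNReal.ofReal_le_ofReal (le_max_right _ _)
    have := modular_div_le_one hp hM h1
    simpa only [div_div, mul_comm η] using this

end Modular

theorem LHInfty.exists_sub_le [MetricSpace X] {p : X → ℝ} (hp : LHInfty p) :
    ∃ (x₀ : X) (K : ℝ), ∀ x y,
      p y - p x ≤ K / Real.log (Real.exp 1 + min (dist x x₀) (dist y x₀)) := by
  obtain ⟨x₀, K, q, h⟩ := hp
  refine ⟨x₀, 2 * K, fun x y => ?_⟩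
  have hK : 0 ≤ K := by
    have := (abs_nonneg _).trans (h x₀)
    simpa using this
  set m := min (dist x x₀) (dist y x₀)
  have hm : 0 ≤ m := le_min dist_nonneg dist_nonneg
  have hl : 0 < Real.log (Real.exp 1 + m) :=
    Real.log_pos ((Real.one_lt_exp_iff.2 one_pos).trans_le (le_add_of_nonneg_right hm))
  have key : ∀ z, m ≤ dist z x₀ → |p z - q| ≤ K / Real.log (Real.exp 1 + m) := fun z hz =>
    (h z).trans (div_le_div_of_nonneg_left hK hl
      (Real.log_le_log (by positivity) (by linarith)))
  have hx := (abs_le.1 (key x (min_le_left _ _))).1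
  have hy := (abs_le.1 (key y (min_le_right _ _))).2
  rw [mul_div_assoc]
  linarith

theorem compBounded_of_densityBounded [MetricSpace X] [MeasurableSpace X] [OpensMeasurableSpace X]
    {μ : Measure X} [SigmaFinite μ] {Q : ℝ} (hQ : 0 < Q) (hμ : AhlforsRegular μ Q)
    {φ : X → X} (hφ : Measure.QuasiMeasurePreserving φ μ μ) {p : X → ℝ} (hp : IsExponent p)
    (hinf : LHInfty p) (hle : ∀ᵐ x ∂μ, p x ≤ p (φ x)) (hd : DensityBounded μ φ) :
    CompBounded μ φ p := by
  obtain ⟨C, hC, hball⟩ := hμ.exists_measure_ball_le hQ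
  obtain ⟨x₀, K, hK⟩ := hinf.exists_sub_le
  set N := Q + 1
  set w : X → ℝ≥0∞ := fun x => ENNReal.ofReal ((Real.exp 1 + dist x x₀) ^ (-N))
  have hwm : Measurable w := by
    refine Measurable.ennreal_ofReal (Measurable.pow_const ?_ _)
    exact (continuous_const.add (continuous_id.dist continuous_const)).measurable
  have hwi : ∫⁻ x, w x ∂μ < ⊤ := lintegral_rpow_neg_dist_lt_top hC hball x₀ hQ
  set u := essSup (density μ φ) μ
  have hu : u < ⊤ := hd
  refine compBounded_of_modular_comp_le hφ hp.2 (A := ENNReal.ofReal (Real.exp (N * K)) * u)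
    (B := ∫⁻ x, w x ∂μ + u * ∫⁻ x, w x ∂μ)
    (ENNReal.mul_ne_top ENNReal.ofReal_ne_top hu.ne)
    (ENNReal.add_ne_top.2 ⟨hwi.ne, ENNReal.mul_ne_top hu.ne hwi.ne⟩) fun f hf => ?_
  set g : X → ℝ≥0∞ := fun y => ENNReal.ofReal (|f y| ^ p y)
  have hgm : AEMeasurable g μ := aemeasurable_modular_integrand hp.1 hf
  have hpt : ∀ᵐ x ∂μ, ENNReal.ofReal (|(f ∘ φ) x| ^ p x) ≤
      ENNReal.ofReal (Real.exp (N * K)) * g (φ x) + (w x + w (φ x)) := by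
    filter_upwards [hle] with x hx
    have hm : 0 ≤ min (dist x x₀) (dist (φ x) x₀) := le_min dist_nonneg dist_nonneg
    have h1 := rpow_le_of_logHolder (F := |f (φ x)|) (abs_nonneg _)
      (le_add_of_nonneg_right hm) (hp.2 x) hx (hK x (φ x)) (N := N) (by positivity)
    have h2 : ENNReal.ofReal ((Real.exp 1 + min (dist x x₀) (dist (φ x) x₀)) ^ (-N)) ≤
        w x + w (φ x) := by
      rcases min_choice (dist x x₀) (dist (φ x) x₀) with h | h <;> rw [h]
      · exact le_self_add
      · exact le_add_self
    refine (ENNReal.ofReal_le_ofReal h1).trans ?_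
    rw [ENNReal.ofReal_add (by positivity) (by positivity),
      ENNReal.ofReal_mul (Real.exp_pos _).le]
    gcongr
  calc modular μ p (f ∘ φ)
      ≤ ∫⁻ x, ENNReal.ofReal (Real.exp (N * K)) * g (φ x) + (w x + w (φ x)) ∂μ :=
        lintegral_mono_ae hpt
    _ = ENNReal.ofReal (Real.exp (N * K)) * ∫⁻ x, g (φ x) ∂μ +
          (∫⁻ x, w x ∂μ + ∫⁻ x, w (φ x) ∂μ) := by
        rw [lintegral_add_right _ (g := fun x => w x + w (φ x))
            (hwm.add (hwm.comp hφ.measurable)),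
          lintegral_add_left hwm, lintegral_const_mul' _ _ ENNReal.ofReal_ne_top]
    _ ≤ ENNReal.ofReal (Real.exp (N * K)) * (u * ∫⁻ x, g x ∂μ) +
          (∫⁻ x, w x ∂μ + u * ∫⁻ x, w x ∂μ) := by
        gcongr
        · exact lintegral_comp_le_of_density hφ hgm
        · exact lintegral_comp_le_of_density hφ hwm.aemeasurable
    _ = _ := by rw [← mul_assoc]; rfl

theorem exists_subset_measure_pos_le [MetricSpace X] [MeasurableSpace X] [OpensMeasurableSpace X]
    [SecondCountableTopology X] {μ : Measure X} {C Q : ℝ} (hQ : 0 < Q)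
    (h : ∀ (x : X) (r : ℝ), 0 < r → μ (ball x r) ≤ ENNReal.ofReal (C * r ^ Q))
    {E : Set X} (hE : MeasurableSet E) (hE0 : μ E ≠ 0) {ε : ℝ≥0∞} (hε : 0 < ε) :
    ∃ F ⊆ E, MeasurableSet F ∧ μ F ≠ 0 ∧ μ F ≤ ε := by
  have hlim : Tendsto (fun r : ℝ => ENNReal.ofReal (C * r ^ Q)) (𝓝[>] 0) (𝓝 0) := by
    have h1 : ContinuousAt (fun r : ℝ => ENNReal.ofReal (C * r ^ Q)) 0 :=
      (ENNReal.continuous_ofReal.continuousAt).comp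
        (continuousAt_const.mul (Real.continuousAt_rpow_const _ _ (.inr hQ.le)))
    have h2 := h1.tendsto
    simp only [Real.zero_rpow hQ.ne', mul_zero, ENNReal.ofReal_zero] at h2
    exact h2.mono_left nhdsWithin_le_nhds
  obtain ⟨r, hrε, hr⟩ := ((hlim.eventually (Iic_mem_nhds hε)).and self_mem_nhdsWithin).exists
  obtain ⟨D, hDc, hD⟩ := TopologicalSpace.exists_countable_dense X
  have hcover : E ⊆ ⋃ c ∈ D, E ∩ ball c r := fun x hx => by
    obtain ⟨c, hc, hxc⟩ := hD.exists_dist_lt x hr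
    exact mem_iUnion₂.2 ⟨c, hc, hx, hxc⟩
  have : ∃ c ∈ D, μ (E ∩ ball c r) ≠ 0 := by
    by_contra! hall
    exact hE0 (measure_mono_null hcover ((measure_biUnion_null_iff hDc).2 hall))
  obtain ⟨c, -, hc⟩ := this
  exact ⟨_, inter_subset_left, hE.inter measurableSet_ball, hc,
    (measure_mono inter_subset_right).trans ((h c r hr).trans hrε)⟩

section

variable [MeasurableSpace X] {μ : Measure X} {φ : X → X} {p : X → ℝ}

theorem mul_measure_le_measure_preimage (hφ : Measurable φ) {a : ℝ≥0∞} {F : Set X}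
    (hF : MeasurableSet F) (ha : ∀ x ∈ F, a ≤ density μ φ x) :
    a * μ F ≤ μ (φ ⁻¹' F) := by
  rw [← Measure.map_apply hφ hF, ← setLIntegral_const]
  exact (setLIntegral_mono' hF ha).trans (Measure.setLIntegral_rnDeriv_le _)

theorem rpow_inv_div_rpow_ge {g t s r P η : ℝ} (ht : 0 < t) (htg : t ≤ g) (hη : 0 < η)
    (hr : 1 ≤ r) (hrs : r ≤ s) (hrP : r ≤ P) (ht1 : 1 ≤ t) (hηt : η ≤ t ^ P⁻¹) :
    t / max 1 η ^ P ≤ (g ^ r⁻¹ / η) ^ s := by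
  have hr0 : 0 < r := by linarith
  have h1 : η ≤ g ^ r⁻¹ := hηt.trans <|
    (Real.rpow_le_rpow_of_exponent_le ht1 (inv_anti₀ hr0 hrP)).trans
      (Real.rpow_le_rpow ht.le htg (by positivity))
  have hg : 0 ≤ g := ht.le.trans htg
  calc t / max 1 η ^ P ≤ g / η ^ r := by
        refine div_le_div₀ hg htg (by positivity) ?_
        exact (Real.rpow_le_rpow hη.le (le_max_right 1 η) hr0.le).trans
          (Real.rpow_le_rpow_of_exponent_le (le_max_left _ _) hrP)
    _ = (g ^ r⁻¹ / η) ^ r := by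
        rw [Real.div_rpow (by positivity) hη.le, Real.rpow_inv_rpow hg hr0.ne']
    _ ≤ _ := Real.rpow_le_rpow_of_exponent_le ((one_le_div hη).2 h1) hrs

theorem densityBounded_of_compMapsInto (hφ : Measure.QuasiMeasurePreserving φ μ μ)
    (hp : IsExponent p) {P : ℝ} (hP1 : 1 ≤ P) (hP : ∀ᵐ x ∂μ, p x ≤ P)
    (hle : ∀ᵐ x ∂μ, p (φ x) ≤ p x)
    (hsmall : ∀ E : Set X, MeasurableSet E → μ E ≠ 0 → ∀ ε : ℝ≥0∞, 0 < ε →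
      ∃ F ⊆ E, MeasurableSet F ∧ μ F ≠ 0 ∧ μ F ≤ ε)
    (hmaps : CompMapsInto μ φ p) : DensityBounded μ φ := by
  by_contra hunb
  have hum : Measurable (density μ φ) := Measure.measurable_rnDeriv _ _
  have hE : ∀ k : ℕ, μ {x | ENNReal.ofReal (4 ^ k) < density μ φ x} ≠ 0 := by
    intro k h0
    refine hunb ((essSup_le_of_ae_le (ENNReal.ofReal (4 ^ k)) ?_).trans_lt ENNReal.ofReal_lt_top)
    rw [EventuallyLE, ae_iff]
    simpa using h0
  choose F hFE hFm hF0 hFle using fun k : ℕ =>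
    hsmall _ (measurableSet_lt measurable_const hum) (hE k) (ENNReal.ofReal ((4 ^ k)⁻¹))
      (ENNReal.ofReal_pos.2 (by positivity))
  have hFtop : ∀ k, μ (F k) ≠ ⊤ := fun k => ((hFle k).trans_lt ENNReal.ofReal_lt_top).ne
  set m : ℕ → ℝ := fun k => (μ (F k)).toReal
  have hm0 : ∀ k, 0 < m k := fun k => ENNReal.toReal_pos (hF0 k) (hFtop k)
  have hmF : ∀ k, μ (F k) = ENNReal.ofReal (m k) := fun k => (ENNReal.ofReal_toReal (hFtop k)).symm
  have hmle : ∀ k, m k ≤ (4 ^ k)⁻¹ := fun k => ENNReal.toReal_le_of_le_ofReal (by positivity) (hFle k)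
  set t : ℕ → ℝ := fun k => (1 / 2) ^ k / m k with ht
  have ht2 : ∀ k, 2 ^ k ≤ t k := fun k => by
    rw [ht, le_div_iff₀ (hm0 k)]
    calc (2 : ℝ) ^ k * m k ≤ 2 ^ k * (4 ^ k)⁻¹ := by gcongr; exact hmle k
      _ = (1 / 2) ^ k := by rw [← inv_pow, ← mul_pow]; norm_num
  set G : X → ℝ≥0∞ := fun x => ∑' k, (F k).indicator (fun _ => ENNReal.ofReal (t k)) x
  have hGm : Measurable G := Measurable.tsum fun k => measurable_const.indicator (hFm k)
  have hGi : ∫⁻ x, G x ∂μ < ⊤ := by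
    rw [lintegral_tsum fun k => (measurable_const.indicator (hFm k)).aemeasurable]
    have hk : ∀ k, ∫⁻ x, (F k).indicator (fun _ => ENNReal.ofReal (t k)) x ∂μ =
        ENNReal.ofReal ((1 / 2) ^ k) := fun k => by
      rw [lintegral_indicator_const (hFm k), hmF, ← ENNReal.ofReal_mul (by positivity),
        div_mul_cancel₀ _ (hm0 k).ne']
    rw [tsum_congr hk, ← ENNReal.ofReal_tsum_of_nonneg (fun k => by positivity)
      (summable_geometric_of_lt_one (by norm_num) (by norm_num))]
    exact ENNReal.ofReal_lt_top
  have hGfin : ∀ᵐ x ∂μ, G x < ⊤ := ae_lt_top hGm hGi.ne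
  set f : X → ℝ := fun x => (G x).toReal ^ (p x)⁻¹
  have hfmem : MemLpVar μ p f := by
    refine ⟨(hGm.ennreal_toReal.pow hp.1.inv).aemeasurable, 1, one_pos, ?_⟩
    refine (lintegral_mono fun x => ?_).trans_lt hGi
    simp only [div_one]
    rw [abs_of_nonneg (by positivity),
      Real.rpow_inv_rpow ENNReal.toReal_nonneg (by linarith [hp.2 x])]
    exact ENNReal.ofReal_toReal_le
  obtain ⟨-, η, hη, hlt⟩ := hmaps f hfmem
  have hH : 0 < max 1 η ^ P := by positivity
  have hbound : ∀ᶠ k : ℕ in atTop, ENNReal.ofReal (2 ^ k / max 1 η ^ P) ≤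
      modular μ p (fun x => (f ∘ φ) x / η) := by
    have hev : ∀ᶠ k : ℕ in atTop, (max 1 η ^ P) ≤ (2 : ℝ) ^ k :=
      (tendsto_pow_atTop_atTop_of_one_lt one_lt_two).eventually_ge_atTop _
    filter_upwards [hev] with k hk
    have ht0 : 0 < t k := (by positivity : (0 : ℝ) < 2 ^ k).trans_le (ht2 k)
    have hηt : η ≤ t k ^ P⁻¹ := by
      rw [Real.le_rpow_inv_iff_of_pos hη.le ht0.le (by linarith)]
      exact (Real.rpow_le_rpow hη.le (le_max_right 1 η) (by linarith)).trans (hk.trans (ht2 k))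
    have hpt : ∀ᵐ x ∂μ, (φ ⁻¹' F k).indicator
        (fun _ => ENNReal.ofReal (t k / max 1 η ^ P)) x ≤
        ENNReal.ofReal (|(f ∘ φ) x / η| ^ p x) := by
      filter_upwards [hle, hφ.ae hP, hφ.ae hGfin] with x hx hPx hGx
      by_cases hxF : x ∈ φ ⁻¹' F k
      · rw [indicator_of_mem hxF]
        refine ENNReal.ofReal_le_ofReal ?_
        have htG : t k ≤ (G (φ x)).toReal := by
          rw [← ENNReal.ofReal_le_iff_le_toReal hGx.ne]
          refine le_trans (le_of_eq ?_) (ENNReal.le_tsum k)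
          rw [indicator_of_mem (show φ x ∈ F k from hxF)]
        have hnn : 0 ≤ (f ∘ φ) x / η := div_nonneg (Real.rpow_nonneg ENNReal.toReal_nonneg _) hη.le
        rw [abs_of_nonneg hnn]
        exact rpow_inv_div_rpow_ge ht0 htG hη (hp.2 _) hx hPx
          ((one_le_pow₀ one_le_two).trans (ht2 k)) hηt
      · rw [indicator_of_notMem hxF]; exact zero_le
    have hF4 : ENNReal.ofReal (4 ^ k) * μ (F k) ≤ μ (φ ⁻¹' F k) :=
      mul_measure_le_measure_preimage hφ.measurable (hFm k) fun x hx => (hFE k hx).le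
    calc ENNReal.ofReal (2 ^ k / max 1 η ^ P)
        = ENNReal.ofReal (t k / max 1 η ^ P) * (ENNReal.ofReal (4 ^ k) * μ (F k)) := by
          rw [hmF, ← ENNReal.ofReal_mul (by positivity), ← ENNReal.ofReal_mul (by positivity)]
          congr 1
          have h42 : (4 : ℝ) ^ k = 2 ^ k * 2 ^ k := by rw [← mul_pow]; norm_num
          have := (hm0 k).ne'
          simp only [ht, h42, one_div, inv_pow]
          field_simp
      _ ≤ ENNReal.ofReal (t k / max 1 η ^ P) * μ (φ ⁻¹' F k) := by gcongr
      _ = ∫⁻ x, (φ ⁻¹' F k).indicator (fun _ => ENNReal.ofReal (t k / max 1 η ^ P)) x ∂μ :=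
          (lintegral_indicator_const (hφ.measurable (hFm k)) _).symm
      _ ≤ _ := lintegral_mono_ae hpt
  have htend : Tendsto (fun k : ℕ => ENNReal.ofReal (2 ^ k / max 1 η ^ P)) atTop (𝓝 ⊤) :=
    ENNReal.tendsto_ofReal_nhds_top.2
      ((tendsto_pow_atTop_atTop_of_one_lt one_lt_two).atTop_div_const hH)
  exact hlt.ne (top_le_iff.1 (le_of_tendsto htend hbound))

end

theorem ballBound_of_densityBounded [MetricSpace X] [MeasurableSpace X] [OpensMeasurableSpace X]
    {μ : Measure X} [SigmaFinite μ] {φ : X → X} (hφ : Measure.QuasiMeasurePreserving φ μ μ)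
    (hd : DensityBounded μ φ) : BallBound μ φ := by
  refine ⟨(essSup (density μ φ) μ).toNNReal + 1, by positivity, fun x r _ => ?_⟩
  rw [← Measure.map_apply hφ.measurable measurableSet_ball]
  refine (map_le_essSup_density_smul hφ _).trans ?_
  rw [Measure.smul_apply, smul_eq_mul, ENNReal.coe_add, ENNReal.coe_toNNReal hd.ne]
  gcongr
  exact le_self_add

theorem BallBound.ballSup_lt_top [MetricSpace X] [MeasurableSpace X]
    {μ : Measure X} {φ : X → X} (h : BallBound μ φ) : ballSup μ φ < ⊤ := by
  obtain ⟨C, -, h⟩ := h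
  refine lt_of_le_of_lt ?_ (ENNReal.coe_lt_top (r := C))
  exact iSup_le fun x => iSup_le fun r => iSup_le fun hr => ENNReal.div_le_of_le_mul (h x r hr)

theorem measure_preimage_ball_le_ballSup_mul [MetricSpace X] [MeasurableSpace X] {μ : Measure X}
    [μ.IsOpenPosMeasure] (hfin : ∀ s : Set X, Bornology.IsBounded s → μ s < ⊤) (φ : X → X)
    (x : X) {r : ℝ} (hr : 0 < r) :
    μ (φ ⁻¹' ball x r) ≤ ballSup μ φ * μ (ball x r) := by
  rw [← ENNReal.div_le_iff (measure_ball_pos μ x hr).ne' (hfin _ isBounded_ball).ne]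
  exact le_trans (le_iSup (fun _ : 0 < r => μ (φ ⁻¹' ball x r) / μ (ball x r)) hr)
    (le_iSup₂_of_le (f := fun x r => ⨆ _ : 0 < r, μ (φ ⁻¹' ball x r) / μ (ball x r)) x r le_rfl)

theorem Doubling.isUnifLocDoublingMeasure [MetricSpace X] [MeasurableSpace X] {μ : Measure X}
    (h : Doubling μ) : IsUnifLocDoublingMeasure μ := by
  obtain ⟨C, -, h⟩ := h
  refine ⟨⟨C * C, ?_⟩⟩
  filter_upwards [self_mem_nhdsWithin] with ε (hε : 0 < ε) x
  calc μ (closedBall x (2 * ε)) ≤ μ (ball x (2 * (2 * ε))) :=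
        measure_mono (closedBall_subset_ball (by linarith))
    _ ≤ C * (C * μ (ball x ε)) :=
        (h x _ (by positivity)).trans (mul_le_mul_right (h x ε hε) _)
    _ ≤ (C * C : ℝ≥0) * μ (closedBall x ε) := by
        rw [ENNReal.coe_mul, mul_assoc]
        gcongr
        exact ball_subset_closedBall

theorem densityBounded_of_ballSup_lt_top [MetricSpace X] [MeasurableSpace X] [BorelSpace X]
    [SecondCountableTopology X] {μ : Measure X} [SigmaFinite μ] [IsLocallyFiniteMeasure μ]
    [μ.IsOpenPosMeasure] (hfin : ∀ s : Set X, Bornology.IsBounded s → μ s < ⊤) {φ : X → X}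
    (hφ : Measurable φ) (hd : Doubling μ) (hs : ballSup μ φ < ⊤) : DensityBounded μ φ := by
  have := hd.isUnifLocDoublingMeasure
  obtain ⟨C, -, hC⟩ := hd
  have hball : ∀ (x : X) {r : ℝ}, 0 < r → μ.map φ (ball x r) ≤ ballSup μ φ * μ (ball x r) :=
    fun x r hr => by
      rw [Measure.map_apply hφ measurableSet_ball]
      exact measure_preimage_ball_le_ballSup_mul hfin φ x hr
  have : IsLocallyFiniteMeasure (μ.map φ) :=
    ⟨fun x => ⟨ball x 1, ball_mem_nhds x one_pos, (hball x one_pos).trans_lt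
      (ENNReal.mul_lt_top hs (hfin _ isBounded_ball))⟩⟩
  have hclosed : ∀ (x : X) (r : ℝ), 0 < r →
      μ.map φ (closedBall x r) / μ (closedBall x r) ≤ ballSup μ φ * C := by
    intro x r hr
    refine ENNReal.div_le_of_le_mul ?_
    calc μ.map φ (closedBall x r) ≤ μ.map φ (ball x (2 * r)) :=
          measure_mono (closedBall_subset_ball (by linarith))
      _ ≤ ballSup μ φ * (C * μ (ball x r)) :=
          (hball x (by positivity)).trans (mul_le_mul_right (hC x r hr) _)
      _ ≤ ballSup μ φ * C * μ (closedBall x r) := by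
          rw [mul_assoc]
          gcongr
          exact ball_subset_closedBall
  refine (essSup_le_of_ae_le (ballSup μ φ * C) ?_).trans_lt
    (ENNReal.mul_lt_top hs ENNReal.coe_lt_top)
  filter_upwards [(IsUnifLocDoublingMeasure.vitaliFamily μ 0).ae_tendsto_rnDeriv (μ.map φ)]
    with x hx
  have hlim := hx.comp (IsUnifLocDoublingMeasure.tendsto_closedBall_filterAt (K := 0) μ
    (fun _ : ℝ => x) id tendsto_id (by simp))
  refine le_of_tendsto hlim ?_
  filter_upwards [self_mem_nhdsWithin] with r hr
  exact hclosed x r hr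

end VarLp

theorem theorem3p2 {X : Type*} [MetricSpace X] [MeasurableSpace X] [BorelSpace X]
    (μ : Measure X) [μ.IsOpenPosMeasure]
    (hfin : ∀ s : Set X, Bornology.IsBounded s → μ s < ⊤)
    (Q : ℝ) (hQ : 0 < Q) (hμ : VarLp.AhlforsRegular μ Q)
    (φ : X → X) (hφ : Measure.QuasiMeasurePreserving φ μ μ)
    (p : X → ℝ) :
    (VarLp.PLogPlus μ φ p → VarLp.DensityBounded μ φ →
      VarLp.CompMapsInto μ φ p ∧ VarLp.CompBounded μ φ p) ∧
    (VarLp.PLogMinus μ φ p → VarLp.expSup μ p univ < ⊤ → VarLp.CompMapsInto μ φ p →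
      VarLp.BallBound μ φ ∧ VarLp.ballSup μ φ < ⊤) ∧
    (VarLp.Doubling μ → VarLp.PLog μ φ p →
      [VarLp.DensityBounded μ φ, VarLp.CompMapsInto μ φ p, VarLp.CompBounded μ φ p,
        VarLp.BallBound μ φ, VarLp.ballSup μ φ < ⊤].TFAE) := by
  have := VarLp.sigmaFinite_of_isBounded_lt_top μ hfin
  have := VarLp.isLocallyFiniteMeasure_of_isBounded_lt_top μ hfin
  have := VarLp.secondCountableTopology_of_sigmaFinite μ
  have hbdd : VarLp.PLogPlus μ φ p → VarLp.DensityBounded μ φ → VarLp.CompBounded μ φ p := by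
    rintro ⟨hp, h0, hinf, hratio⟩ hd
    obtain ⟨P, -, hP⟩ := hinf.exists_le
    exact VarLp.compBounded_of_densityBounded hQ hμ hφ hp hinf
      (VarLp.ae_le_comp_of_one_le_ratioPlus hφ.measurable h0.continuous hp
        (VarLp.expSup_lt_top_of_le hP) hratio) hd
  have hdens : VarLp.PLogMinus μ φ p → VarLp.expSup μ p univ < ⊤ → VarLp.CompMapsInto μ φ p →
      VarLp.DensityBounded μ φ := by
    rintro ⟨hp, h0, hratio⟩ hsup hmaps
    obtain ⟨C, -, hball⟩ := hμ.exists_measure_ball_le hQ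
    refine VarLp.densityBounded_of_compMapsInto hφ hp (le_max_left 1 (VarLp.expSup μ p univ).toReal)
      ?_ (VarLp.ae_comp_le_of_ratioMinus_le_one hφ.measurable h0.continuous hp hratio)
      (fun E hE hE0 ε hε => VarLp.exists_subset_measure_pos_le hQ hball hE hE0 hε) hmaps
    have := ENNReal.ae_le_essSup (μ := μ.restrict univ) (fun x => ENNReal.ofReal (p x))
    rw [Measure.restrict_univ] at this
    filter_upwards [this] with x hx
    refine le_max_of_le_right ((ENNReal.ofReal_le_iff_le_toReal hsup.ne).1 ?_)
    rwa [VarLp.expSup, Measure.restrict_univ]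
  refine ⟨fun h hd => ⟨(hbdd h hd).1, hbdd h hd⟩, fun h hsup hmaps => ?_, fun hdoub h => ?_⟩
  · have := VarLp.ballBound_of_densityBounded hφ (hdens h hsup hmaps)
    exact ⟨this, this.ballSup_lt_top⟩
  · obtain ⟨P, -, hP⟩ := h.1.2.2.1.exists_le
    tfae_have 1 → 3 := hbdd h.1
    tfae_have 3 → 2 := fun hb => hb.1
    tfae_have 2 → 1 := hdens h.2 (VarLp.expSup_lt_top_of_le hP _)
    tfae_have 1 → 4 := VarLp.ballBound_of_densityBounded hφ
    tfae_have 4 → 5 := fun hb => hb.ballSup_lt_top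
    tfae_have 5 → 1 := VarLp.densityBounded_of_ballSup_lt_top hfin hφ.measurable hdoub
    tfae_finish
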